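/- Let $G$ be a finite group. For a subgroup $H\subseteq G$ let $\mathcal{R}ep_H$ be the category of finite-dimensional orthogonal $H$-representations, enriched so that the space of morphisms $V\to W$ is the $H$-space of all linear isometric embeddings $V\to W$, with $H$ acting by conjugation, and let $H\mathrm{Top}_*$ be the category of pointed $H$-spaces and all pointed maps, likewise with the conjugation action. Let $\mathfrak J_G:G/H\mapsto\mathcal{R}ep_H$ and $\mathfrak T_G:G/H\mapsto H\mathrm{Top}_*$ be the resulting presheaves of categories on the orbit category of $G$, with restriction along $xK\mapsto xgH$ (where $g^{-1}Kg\subseteq H$) given by restriction of actions along $K\to H$, $k\mapsto g^{-1}kg$. An equivariant Weiss functor $E:\mathfrak J_G\to\mathfrak T_G$ consists of continuous $H$-functors $E_{G/H}:\mathcal{R}ep_H\to H\mathrm{Top}_*$, for all $H\subseteq G$, which commute with these restrictions up to coherent natural isomorphism; a 2-morphism $E\to F$ consists of equivariant pointed maps $E_{G/H}(W)\to F_{G/H}(W)$, natural in $W$ with respect to all isometric embeddings and compatible with the restrictions. For a $G$-representation $\alpha$ put $$(\tau_\alpha E)_{G/H}(W)=\operatorname{holim}_{0\neq U\subseteq\alpha}\widehat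 E_{G/H}(W\oplus U),$$ where $U$ runs over the topological poset of nonzero linear subspaces of $\alpha$, on which $H$ acts by translation, where $\widehat E_{G/H}$ is the (enriched) right Kan extension of $E_{G/H}$ to inner product spaces without action, so that a point of $\widehat E_{G/H}(X)$ is a continuous natural family of maps $\{\text{isometric embeddings }X\to V\}\to E_{G/H}(V)$, $V\in\mathcal{R}ep_H$, and where $\operatorname{holim}$ is the totalization of the cosimplicial space of continuous sections of $(U_0\subseteq\dots\subseteq U_n)\mapsto\widehat E_{G/H}(W\oplus U_n)$, with $H$ acting by $(h\Phi)(U_0\subseteq\dots\subseteq U_n)=h\,\Phi(h^{-1}U_0\subseteq\dots\subseteq h^{-1}U_n)$. The maps $E(W)\to E(W\oplus U)$ define a 2-morphism $\eta:E\to\tau_\alpha E$. Put $\tau_\alpha^{(0)}E=E$ and $\tau_\alpha^{(n+1)}E=\tau_\alpha(\tau_\alpha^{(n)}E)$. Let $\varepsilon$ be a $1$-dimensional $G$-representation. For every $G$-representation $\alpha$ and every equivariant Weiss functor $E:\mathfrak J_G\to\mathfrak T_G$ let $$T_{(\alpha,\varepsilon)}E=\operatorname{hocolim}_{n\in\mathbb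 N}\ \tau_{\alpha\oplus\varepsilon}^{(n)}E:\ \mathfrak J_G\to\mathfrak T_G,$$ the objectwise pointed mapping telescope of the maps $\tau^{(n)}_{\alpha\oplus\varepsilon}(\eta)$; this is an equivariant Weiss functor, the $\alpha$-th Taylor approximation of $E$ in the direction of $\varepsilon$. Then there are 2-morphisms, natural in $E$, (i) $\eta^E_{\alpha,\varepsilon}:E\to T_{(\alpha,\varepsilon)}E$, the canonical map of $E=\tau^{(0)}_{\alpha\oplus\varepsilon}E$ to the homotopy colimit, and (ii) $\eta^E_{\alpha,\alpha',\varepsilon}:T_{(\alpha,\varepsilon)}E\to T_{(\alpha',\varepsilon)}E$ for every subrepresentation $\alpha'\subseteq\alpha$ (more generally, for every equivariant isometric embedding $\alpha'\to\alpha$), induced by restricting the homotopy limits from the nonzero subspaces of $\alpha\oplus\varepsilon$ to those of $\alpha'\oplus\varepsilon$, such that $$\eta^E_{\alpha',\varepsilon}=\eta^E_{\alpha,\alpha',\varepsilon}\circ\eta^E_{\alpha,\varepsilon},\qquad \eta^E_{\alpha',\alpha'',\varepsilon}\circ\eta^E_{\alpha,\alpha',\varepsilon}=\eta^E_{\alpha,\alpha'',\varepsilon}\quad\text{for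 }\alpha''\subseteq\alpha'\subseteq\alpha.$$ -/

import Mathlib

open CategoryTheory

universe u

namespace WeissCalculus

set_option linter.unusedSectionVars false

noncomputable section

/-! ### Spaces of subspaces, flags and isometric embeddings -/

/-- The topology on the set of linear isometric embeddings, as a subspace of the normed space of
bounded linear maps. -/
instance isometryTopology {V W : Type*} [NormedAddCommGroup V] [InnerProductSpace ℝ V]
    [NormedAddCommGroup W] [InnerProductSpace ℝ W] : TopologicalSpace (V →ₗᵢ[ℝ] W) :=
  TopologicalSpace.induced LinearIsometry.toContinuousLinearMap inferInstance

/-- The nonzero linear subspaces of `A`, ordered by inclusion. -/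
def NzSub (A : Type*) [NormedAddCommGroup A] [InnerProductSpace ℝ A] : Type _ :=
  {U : Submodule ℝ A // U ≠ ⊥}

section Cells

variable {A A₁ A₂ W W₁ W₂ V V₁ V₂ : Type u}
  [NormedAddCommGroup A] [InnerProductSpace ℝ A] [FiniteDimensional ℝ A]
  [NormedAddCommGroup A₁] [InnerProductSpace ℝ A₁] [FiniteDimensional ℝ A₁]
  [NormedAddCommGroup A₂] [InnerProductSpace ℝ A₂] [FiniteDimensional ℝ A₂]
  [NormedAddCommGroup W] [InnerProductSpace ℝ W] [FiniteDimensional ℝ W]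
  [NormedAddCommGroup W₁] [InnerProductSpace ℝ W₁] [FiniteDimensional ℝ W₁]
  [NormedAddCommGroup W₂] [InnerProductSpace ℝ W₂] [FiniteDimensional ℝ W₂]
  [NormedAddCommGroup V] [InnerProductSpace ℝ V] [FiniteDimensional ℝ V]
  [NormedAddCommGroup V₁] [InnerProductSpace ℝ V₁] [FiniteDimensional ℝ V₁]
  [NormedAddCommGroup V₂] [InnerProductSpace ℝ V₂] [FiniteDimensional ℝ V₂]

instance : PartialOrder (NzSub A) := inferInstanceAs (PartialOrder {U : Submodule ℝ A // U ≠ ⊥})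

/-- The Grassmannian topology: a subspace is identified with its orthogonal projection. -/
instance : TopologicalSpace (NzSub A) :=
  TopologicalSpace.induced (fun U => U.1.starProjection) inferInstance

/-- The image of a nonzero subspace under a linear isometric embedding. -/
def NzSub.map (i : A →ₗᵢ[ℝ] A₁) : NzSub A →o NzSub A₁ where
  toFun U := ⟨U.1.map i.toLinearMap, fun h => U.2 (Submodule.map_injective_of_injective
    (f := i.toLinearMap) i.injective (h.trans (Submodule.map_bot _).symm))⟩
  monotone' _ _ h := Submodule.map_mono h

variable (A) in
/-- `n`-simplices of the nerve of the poset of nonzero subspaces of `A`: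
chains `U₀ ≤ U₁ ≤ ⋯ ≤ Uₙ`. -/
def Flag (n : ℕ) : Type u := Fin (n + 1) →o NzSub A

instance (n : ℕ) : TopologicalSpace (Flag A n) :=
  TopologicalSpace.induced (fun (U : Fin (n + 1) →o NzSub A) (k : Fin (n + 1)) => U k)
    inferInstance

/-- The `k`-th subspace of a flag. -/
def Flag.sub {n : ℕ} (U : Flag A n) (k : Fin (n + 1)) : Submodule ℝ A :=
  ((show Fin (n + 1) →o NzSub A from U) k).1

/-- The simplicial structure of the nerve. -/
def Flag.pull {m n : ℕ} (U : Flag A n) (σ : Fin (m + 1) →o Fin (n + 1)) : Flag A m :=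
  OrderHom.comp (show Fin (n + 1) →o NzSub A from U) σ

/-- The image of a flag under a linear isometric embedding. -/
def Flag.map {n : ℕ} (i : A →ₗᵢ[ℝ] A₁) (U : Flag A n) : Flag A₁ n :=
  OrderHom.comp (NzSub.map i) (show Fin (n + 1) →o NzSub A from U)

lemma Flag.ext {n : ℕ} {U U₁ : Flag A n} (h : ∀ k, U.sub k = U₁.sub k) : U = U₁ :=
  OrderHom.ext _ _ (funext fun k => Subtype.ext (h k))

lemma Flag.mono {n : ℕ} (U : Flag A n) {k l : Fin (n + 1)} (h : k ≤ l) : U.sub k ≤ U.sub l :=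
  OrderHom.monotone (show Fin (n + 1) →o NzSub A from U) h

@[simp] lemma Flag.sub_map {n : ℕ} (i : A →ₗᵢ[ℝ] A₁) (U : Flag A n) (k : Fin (n + 1)) :
    (U.map i).sub k = (U.sub k).map i.toLinearMap := rfl

@[simp] lemma Flag.sub_pull {m n : ℕ} (U : Flag A n) (σ : Fin (m + 1) →o Fin (n + 1))
    (k : Fin (m + 1)) : (U.pull σ).sub k = U.sub (σ k) := rfl

variable (A W V) in
/-- The space of pairs `(U₀ ≤ ⋯ ≤ Uₙ, f)` of an `n`-simplex of the nerve of the poset of nonzero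
subspaces of `A` and a linear isometric embedding `f : W ⊕ Uₙ → V`.  Such an `f` is recorded by its
restriction `a` to `W` and by the extension `b` of its restriction to `Uₙ` which vanishes on the
orthogonal complement of `Uₙ` in `A`. -/
def Cell (n : ℕ) : Type u :=
  {c : Flag A n × (W →L[ℝ] V) × (A →L[ℝ] V) //
    (∀ w, ∀ x ∈ c.1.sub (Fin.last n), ‖c.2.1 w + c.2.2 x‖ ^ 2 = ‖w‖ ^ 2 + ‖x‖ ^ 2) ∧
      ∀ y ∈ (c.1.sub (Fin.last n))ᗮ, c.2.2 y = 0}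

namespace Cell

instance (n : ℕ) : TopologicalSpace (Cell A W V n) := inferInstanceAs (TopologicalSpace
  {c : Flag A n × (W →L[ℝ] V) × (A →L[ℝ] V) //
    (∀ w, ∀ x ∈ c.1.sub (Fin.last n), ‖c.2.1 w + c.2.2 x‖ ^ 2 = ‖w‖ ^ 2 + ‖x‖ ^ 2) ∧
      ∀ y ∈ (c.1.sub (Fin.last n))ᗮ, c.2.2 y = 0})

variable {n : ℕ}

/-- The flag `U₀ ≤ ⋯ ≤ Uₙ`. -/
def flag (c : Cell A W V n) : Flag A n := c.1.1

/-- The restriction to `W` of the isometric embedding. -/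
def fst (c : Cell A W V n) : W →L[ℝ] V := c.1.2.1

/-- The restriction to `Uₙ` of the isometric embedding, extended by zero. -/
def snd (c : Cell A W V n) : A →L[ℝ] V := c.1.2.2

lemma isom (c : Cell A W V n) (w : W) {x : A} (hx : x ∈ c.flag.sub (Fin.last n)) :
    ‖c.fst w + c.snd x‖ ^ 2 = ‖w‖ ^ 2 + ‖x‖ ^ 2 := c.2.1 w x hx

lemma vanish (c : Cell A W V n) {y : A} (hy : y ∈ (c.flag.sub (Fin.last n))ᗮ) :
    c.snd y = 0 := c.2.2 y hy

lemma ext {c d : Cell A W V n} (h : c.flag = d.flag) (h₁ : c.fst = d.fst) (h₂ : c.snd = d.snd) :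
    c = d := Subtype.ext (Prod.ext h (Prod.ext h₁ h₂))

/-- The restriction to `W` of the isometric embedding `W ⊕ Uₙ → V`, as an isometric embedding. -/
def base (c : Cell A W V n) : W →ₗᵢ[ℝ] V where
  toLinearMap := c.fst
  norm_map' w := by
    have h := c.isom w (Submodule.zero_mem _)
    simp only [map_zero, add_zero, norm_zero, ne_eq, OfNat.ofNat_ne_zero, not_false_eq_true,
      zero_pow] at h
    exact (sq_eq_sq₀ (norm_nonneg _) (norm_nonneg _)).1 h

/-- The face and degeneracy operators: replace the flag `U` by `U ∘ σ` and restrict the isometric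
embedding to `W ⊕ U_{σ m}`, where `U_{σ m} ≤ Uₙ` is the largest member of `U ∘ σ`. -/
def pull {m : ℕ} (σ : Fin (m + 1) →o Fin (n + 1)) (c : Cell A W V n) : Cell A W V m :=
  ⟨(c.flag.pull σ, c.fst, c.snd.comp (c.flag.sub (σ (Fin.last m))).starProjection), by
    constructor
    · intro w x hx
      have hx1 : x ∈ c.flag.sub (σ (Fin.last m)) := hx
      have h := c.isom w (c.flag.mono (Fin.le_last _) hx1)
      simpa [Submodule.starProjection_eq_self_iff.2 hx1] using h
    · intro y hy
      have hy1 : y ∈ (c.flag.sub (σ (Fin.last m)))ᗮ := hy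
      simp [(Submodule.starProjection_apply_eq_zero_iff _).2 hy1]⟩

/-- Transport of an embedding `f : W ⊕ Uₙ → V` along linear isometric embeddings
`i : A → A₁`, `w : W₁ → W`, `v : V → V₁`: the embedding
`v ∘ f ∘ (w ⊕ i⁻¹) : W₁ ⊕ i Uₙ → V₁`.  (The extension by zero is expressed with the adjoint
of `i`.) -/
def trans (i : A →ₗᵢ[ℝ] A₁) (w : W₁ →ₗᵢ[ℝ] W) (v : V →ₗᵢ[ℝ] V₁) (c : Cell A W V n) :
    Cell A₁ W₁ V₁ n :=
  ⟨(c.flag.map i, v.toContinuousLinearMap.comp (c.fst.comp w.toContinuousLinearMap),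
    v.toContinuousLinearMap.comp
      (c.snd.comp (ContinuousLinearMap.adjoint i.toContinuousLinearMap))), by
    constructor
    · rintro x y ⟨z, hz, rfl⟩
      have h := c.isom (w x) hz
      have e : ContinuousLinearMap.adjoint i.toContinuousLinearMap (i z) = z :=
        ext_inner_right ℝ fun y => by
          rw [ContinuousLinearMap.adjoint_inner_left]; exact i.inner_map_map z y
      simp only [LinearIsometry.norm_map] at h
      simp only [ContinuousLinearMap.comp_apply, LinearIsometry.coe_toContinuousLinearMap,
        LinearIsometry.coe_toLinearMap, e, ← map_add, LinearIsometry.norm_map, h]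
    · intro y hy
      have h : ContinuousLinearMap.adjoint i.toContinuousLinearMap y ∈
          (c.flag.sub (Fin.last n))ᗮ := by
        rw [Submodule.mem_orthogonal] at hy ⊢
        intro x hx
        rw [ContinuousLinearMap.adjoint_inner_right]
        exact hy _ ⟨x, hx, rfl⟩
      simp [c.vanish h]⟩

lemma trans_trans (i : A →ₗᵢ[ℝ] A₁) (w : W₁ →ₗᵢ[ℝ] W) (v : V →ₗᵢ[ℝ] V₁)
    (i₁ : A₁ →ₗᵢ[ℝ] A₂) (w₁ : W₂ →ₗᵢ[ℝ] W₁) (v₁ : V₁ →ₗᵢ[ℝ] V₂) (c : Cell A W V n) :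
    (c.trans i w v).trans i₁ w₁ v₁ = c.trans (i₁.comp i) (w.comp w₁) (v₁.comp v) := by
  refine ext (Flag.ext fun k => ?_) rfl ?_
  · exact (Submodule.map_comp _ _ _).symm
  · have e : (i₁.comp i).toContinuousLinearMap =
        i₁.toContinuousLinearMap.comp i.toContinuousLinearMap := rfl
    change _ = (v₁.comp v).toContinuousLinearMap.comp (c.snd.comp
      (ContinuousLinearMap.adjoint (i₁.comp i).toContinuousLinearMap))
    rw [e, ContinuousLinearMap.adjoint_comp]
    rfl

lemma trans_id (c : Cell A W V n) :
    c.trans LinearIsometry.id LinearIsometry.id LinearIsometry.id = c := by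
  refine ext (Flag.ext fun k => ?_) rfl ?_
  · exact Submodule.map_id _
  · have e : (LinearIsometry.id : A →ₗᵢ[ℝ] A).toContinuousLinearMap =
      ContinuousLinearMap.id ℝ A := rfl
    change (LinearIsometry.id : V →ₗᵢ[ℝ] V).toContinuousLinearMap.comp (c.snd.comp
      (ContinuousLinearMap.adjoint (LinearIsometry.id : A →ₗᵢ[ℝ] A).toContinuousLinearMap)) = _
    rw [e, ContinuousLinearMap.adjoint_id]
    rfl

lemma starProjection_map (i : A →ₗᵢ[ℝ] A₁) (U : Submodule ℝ A) :
    (U.map i.toLinearMap).starProjection = i.toContinuousLinearMap.comp (U.starProjection.comp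
      (ContinuousLinearMap.adjoint i.toContinuousLinearMap)) := by
  ext x
  refine (Submodule.eq_starProjection_of_mem_of_inner_eq_zero
    ⟨_, Submodule.starProjection_apply_mem U _, rfl⟩ ?_)
  rintro _ ⟨y, hy, rfl⟩
  have h := Submodule.starProjection_inner_eq_zero (K := U)
    (ContinuousLinearMap.adjoint i.toContinuousLinearMap x) y hy
  rw [inner_sub_left, ContinuousLinearMap.adjoint_inner_left] at h
  rw [inner_sub_left]
  rw [← h]
  congr 1
  exact i.inner_map_map _ _

lemma trans_pull {m : ℕ} (σ : Fin (m + 1) →o Fin (n + 1)) (i : A →ₗᵢ[ℝ] A₁) (w : W₁ →ₗᵢ[ℝ] W)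
    (v : V →ₗᵢ[ℝ] V₁) (c : Cell A W V n) :
    (c.trans i w v).pull σ = (c.pull σ).trans i w v := by
  refine ext (Flag.ext fun k => rfl) rfl ?_
  have e : (ContinuousLinearMap.adjoint i.toContinuousLinearMap).comp i.toContinuousLinearMap =
      ContinuousLinearMap.id ℝ A := by
    ext z
    refine ext_inner_right ℝ fun y => ?_
    rw [ContinuousLinearMap.comp_apply, ContinuousLinearMap.adjoint_inner_left]
    exact i.inner_map_map z y
  have e1 : ∀ z, ContinuousLinearMap.adjoint i.toContinuousLinearMap (i z) = z := fun z =>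
    congrArg (fun f : A →L[ℝ] A => f z) e
  change (v.toContinuousLinearMap.comp (c.snd.comp
      (ContinuousLinearMap.adjoint i.toContinuousLinearMap))).comp
    ((c.flag.sub (σ (Fin.last m))).map i.toLinearMap).starProjection = _
  rw [starProjection_map]
  ext z
  change v (c.snd (ContinuousLinearMap.adjoint i.toContinuousLinearMap (i _))) = _
  rw [e1]
  rfl

@[simp] lemma base_pull {m : ℕ} (σ : Fin (m + 1) →o Fin (n + 1)) (c : Cell A W V n) :
    (c.pull σ).base = c.base := rfl

@[simp] lemma base_trans (i : A →ₗᵢ[ℝ] A₁) (w : W₁ →ₗᵢ[ℝ] W) (v : V →ₗᵢ[ℝ] V₁)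
    (c : Cell A W V n) : (c.trans i w v).base = v.comp (c.base.comp w) := rfl

lemma continuous_fst : Continuous (fst : Cell A W V n → _) :=
  _root_.continuous_fst.comp (_root_.continuous_snd.comp continuous_subtype_val)

lemma continuous_snd : Continuous (snd : Cell A W V n → _) :=
  _root_.continuous_snd.comp (_root_.continuous_snd.comp continuous_subtype_val)

lemma continuous_proj (k : Fin (n + 1)) :
    Continuous (fun c : Cell A W V n => (c.flag.sub k).starProjection) := by
  have h1 : Continuous (flag : Cell A W V n → _) :=
    _root_.continuous_fst.comp continuous_subtype_val
  have h2 : Continuous (fun U : Flag A n => (show Fin (n + 1) →o NzSub A from U) k) :=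
    (continuous_apply k).comp continuous_induced_dom
  exact (continuous_induced_dom (f := fun U : NzSub A => U.1.starProjection)).comp (h2.comp h1)

/-- The topology of a space of cells, described through linear maps. -/
lemma continuous_iff {X : Type*} [TopologicalSpace X] {f : X → Cell A W V n} :
    Continuous f ↔ (∀ k, Continuous fun x => ((f x).flag.sub k).starProjection) ∧
      (Continuous fun x => (f x).fst) ∧ Continuous fun x => (f x).snd := by
  constructor
  · intro h
    exact ⟨fun k => (continuous_proj k).comp h, continuous_fst.comp h, continuous_snd.comp h⟩
  · rintro ⟨h1, h2, h3⟩
    refine Continuous.subtype_mk (Continuous.prodMk ?_ (Continuous.prodMk h2 h3)) _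
    refine continuous_induced_rng.2 (continuous_pi fun k => continuous_induced_rng.2 (h1 k))

lemma continuous_base : Continuous (base : Cell A W V n → _) :=
  continuous_induced_rng.2 continuous_fst

lemma continuous_trans {X : Type*} [TopologicalSpace X] (i : A →ₗᵢ[ℝ] A₁)
    {w : X → W₁ →ₗᵢ[ℝ] W} (hw : Continuous w) (v : V →ₗᵢ[ℝ] V₁) {c : X → Cell A W V n}
    (hc : Continuous c) : Continuous fun x => (c x).trans i (w x) v := by
  obtain ⟨h1, h2, h3⟩ := continuous_iff.1 hc
  refine continuous_iff.2 ⟨fun k => ?_, ?_, ?_⟩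
  · have : (fun x => (((c x).trans i (w x) v).flag.sub k).starProjection) = fun x =>
      i.toContinuousLinearMap.comp (((c x).flag.sub k).starProjection.comp
        (ContinuousLinearMap.adjoint i.toContinuousLinearMap)) :=
      funext fun x => starProjection_map i _
    rw [this]
    exact continuous_const.clm_comp ((h1 k).clm_comp continuous_const)
  · have hw1 : Continuous fun x => (w x).toContinuousLinearMap := continuous_induced_dom.comp hw
    exact continuous_const.clm_comp (h2.clm_comp hw1)
  · exact continuous_const.clm_comp (h3.clm_comp continuous_const)

lemma isInducing : Topology.IsInducing (fun c : Cell A W V n =>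
    ((fun k => (c.flag.sub k).starProjection : Fin (n + 1) → A →L[ℝ] A), c.fst, c.snd)) := by
  have h1 : Topology.IsInducing (fun U : NzSub A => U.1.starProjection) := ⟨rfl⟩
  have h2 : Topology.IsInducing (fun (U : Flag A n) (k : Fin (n + 1)) =>
    (show Fin (n + 1) →o NzSub A from U) k) := ⟨rfl⟩
  have h3 := (Topology.IsInducing.piMap fun _ : Fin (n + 1) => h1).comp h2
  exact (h3.prodMap Topology.IsInducing.id).comp Topology.IsInducing.subtypeVal

lemma range_eq : Set.range (fun c : Cell A W V n =>
    ((fun k => (c.flag.sub k).starProjection : Fin (n + 1) → A →L[ℝ] A), c.fst, c.snd)) =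
    {p | (∀ k, IsSelfAdjoint (p.1 k)) ∧ (∀ k, p.1 k * p.1 k = p.1 k) ∧
      (∀ k, 1 ≤ ‖p.1 k‖) ∧ (∀ k l, k ≤ l → p.1 l * p.1 k = p.1 k) ∧
      (∀ w x, ‖p.2.1 w + p.2.2 (p.1 (Fin.last n) x)‖ ^ 2 =
        ‖w‖ ^ 2 + ‖p.1 (Fin.last n) x‖ ^ 2) ∧ p.2.2.comp (p.1 (Fin.last n)) = p.2.2} := by
  ext ⟨P, a, b⟩
  constructor
  · rintro ⟨c, h⟩
    obtain ⟨rfl, rfl, rfl⟩ := by simpa only [Prod.mk.injEq] using h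
    refine ⟨fun k => isSelfAdjoint_starProjection _,
      fun k => Submodule.isIdempotentElem_starProjection _, fun k => ?_, fun k l hkl => ?_,
      fun w x => c.isom w (Submodule.starProjection_apply_mem _ _), ?_⟩
    · refine (Submodule.norm_starProjection (K := c.flag.sub k) ?_).ge
      exact ((show Fin (n + 1) →o NzSub A from c.flag) k).2
    · ext x
      exact Submodule.starProjection_eq_self_iff.2
        (c.flag.mono hkl (Submodule.starProjection_apply_mem _ _))
    · ext x
      have h1 := c.vanish
        (Submodule.sub_starProjection_mem_orthogonal (K := c.flag.sub (Fin.last n)) x)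
      rw [map_sub, sub_eq_zero] at h1
      exact h1.symm
  · rintro ⟨h1, h2, h3, h4, h5, h6⟩
    have hP : ∀ k, P k = (P k).range.starProjection := fun k =>
      (isStarProjection_iff_eq_starProjection_range.1 ⟨h2 k, h1 k⟩).2
    have hfix : ∀ k, ∀ x ∈ (P k).range, P k x = x := by
      rintro k _ ⟨y, rfl⟩
      exact congrArg (fun f : A →L[ℝ] A => f y) (h2 k)
    let U : Flag A n := (⟨fun k => ⟨(P k).range, fun h => by
        have h7 := h3 k
        have h8 : P k = 0 := by
          ext x
          have : P k x ∈ (P k).range := ⟨x, rfl⟩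
          rw [h] at this
          simpa using this
        change 1 ≤ ‖P k‖ at h7
        rw [h8, norm_zero] at h7
        linarith⟩, fun k l hkl => by
        rintro _ ⟨y, rfl⟩
        exact ⟨P k y, congrArg (fun f : A →L[ℝ] A => f y) (h4 k l hkl)⟩⟩ :
        Fin (n + 1) →o NzSub A)
    refine ⟨⟨(U, a, b), ?_, ?_⟩, ?_⟩
    · intro w x hx
      have h7 := h5 w x
      have h8 : P (Fin.last n) x = x := hfix _ x hx
      simpa only [h8] using h7
    · intro y hy
      have hy1 : y ∈ (P (Fin.last n)).rangeᗮ := hy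
      have h7 : P (Fin.last n) y = 0 := by
        rw [hP]
        exact (Submodule.starProjection_apply_eq_zero_iff _).2 hy1
      rw [← h6]
      simp [h7]
    · exact Prod.ext (funext fun k => (hP k).symm) rfl

instance locallyCompactSpace : LocallyCompactSpace (Cell A W V n) := by
  have hinj : Function.Injective (fun c : Cell A W V n =>
      ((fun k => (c.flag.sub k).starProjection : Fin (n + 1) → A →L[ℝ] A), c.fst, c.snd)) := by
    intro c d h
    exact ext (Flag.ext fun k => Submodule.starProjection_inj.1 (congrFun (congrArg Prod.fst h) k))
      (congrArg (fun z => z.2.1) h) (congrArg (fun z => z.2.2) h)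
  refine (Topology.IsClosedEmbedding.mk ⟨isInducing, hinj⟩ ?_).locallyCompactSpace
  have hk : ∀ k, Continuous fun p : (Fin (n + 1) → A →L[ℝ] A) × (W →L[ℝ] V) × (A →L[ℝ] V) =>
    p.1 k := fun k => (continuous_apply k).comp _root_.continuous_fst
  have ha : Continuous fun p : (Fin (n + 1) → A →L[ℝ] A) × (W →L[ℝ] V) × (A →L[ℝ] V) =>
    p.2.1 := _root_.continuous_fst.comp _root_.continuous_snd
  have hb : Continuous fun p : (Fin (n + 1) → A →L[ℝ] A) × (W →L[ℝ] V) × (A →L[ℝ] V) =>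
    p.2.2 := _root_.continuous_snd.comp _root_.continuous_snd
  rw [range_eq]
  simp only [Set.ofPred_and, Set.ofPred_forall]
  refine IsClosed.inter (isClosed_iInter fun k => ?_) <|
    IsClosed.inter (isClosed_iInter fun k => ?_) <|
    IsClosed.inter (isClosed_iInter fun k => ?_) <|
    IsClosed.inter (isClosed_iInter fun k => isClosed_iInter fun l => isClosed_iInter fun _ => ?_)
      <| IsClosed.inter (isClosed_iInter fun w => isClosed_iInter fun x => ?_) ?_
  · exact isClosed_eq (continuous_star.comp (hk k)) (hk k)
  · exact isClosed_eq ((hk k).mul (hk k)) (hk k)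
  · exact isClosed_le continuous_const (hk k).norm
  · exact isClosed_eq ((hk l).mul (hk k)) (hk k)
  · have hx := (hk (Fin.last n)).clm_apply (continuous_const (y := x))
    exact isClosed_eq (((ha.clm_apply continuous_const).add (hb.clm_apply hx)).norm.pow 2)
      (continuous_const.add (hx.norm.pow 2))
  · exact isClosed_eq (hb.clm_comp (hk _)) hb

end Cell

end Cells

/-! ### Orthogonal representations and pointed spaces with an action -/

/-- A finite dimensional orthogonal representation of a group. -/
structure OrthRep (Γ : Type u) [Group Γ] where
  /-- The underlying inner product space. -/
  carrier : Type u
  [normed : NormedAddCommGroup carrier]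
  [ips : InnerProductSpace ℝ carrier]
  [findim : FiniteDimensional ℝ carrier]
  /-- The action by linear isometries. -/
  act : Γ →* (carrier ≃ₗᵢ[ℝ] carrier)

attribute [instance] OrthRep.normed OrthRep.ips OrthRep.findim

namespace OrthRep

variable {Γ Γ₁ : Type u} [Group Γ] [Group Γ₁]

/-- The action of a group element, as a linear isometric embedding. -/
def iso (V : OrthRep Γ) (h : Γ) : V.carrier →ₗᵢ[ℝ] V.carrier := (V.act h).toLinearIsometry

/-- Restriction along a group homomorphism. -/
abbrev res (φ : Γ₁ →* Γ) (V : OrthRep Γ) : OrthRep Γ₁ where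
  carrier := V.carrier
  act := V.act.comp φ

/-- The trivial action of a group on the space underlying a representation of another group. -/
abbrev trivial (Γ : Type u) [Group Γ] (V : OrthRep Γ₁) : OrthRep Γ where
  carrier := V.carrier
  act := 1

/-- The conjugation action on linear isometric embeddings. -/
def conj {V W : OrthRep Γ} (h : Γ) (f : V.carrier →ₗᵢ[ℝ] W.carrier) :
    V.carrier →ₗᵢ[ℝ] W.carrier := (W.iso h).comp (f.comp (V.iso h⁻¹))

lemma iso_mul (V : OrthRep Γ) (g h : Γ) : V.iso (g * h) = (V.iso g).comp (V.iso h) := by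
  ext x; simp [iso]

lemma iso_one (V : OrthRep Γ) : V.iso 1 = LinearIsometry.id := by
  ext x; simp [iso]

lemma iso_res (V : OrthRep Γ) (φ : Γ₁ →* Γ) (k : Γ₁) : (V.res φ).iso k = V.iso (φ k) := rfl

/-- The direct sum of two orthogonal representations. -/
def sum (V W : OrthRep Γ) : OrthRep Γ where
  carrier := WithLp 2 (V.carrier × W.carrier)
  act :=
    { toFun := fun g => LinearIsometryEquiv.withLpProdCongr 2 (V.act g) (W.act g)
      map_one' := by rw [map_one, map_one]; rfl
      map_mul' := fun g h => by rw [map_mul, map_mul]; rfl }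

/-- An equivariant linear isometric embedding, for instance the inclusion of a
subrepresentation. -/
structure Emb (V W : OrthRep Γ) where
  /-- The underlying linear isometric embedding. -/
  toIsom : V.carrier →ₗᵢ[ℝ] W.carrier
  equivariant : ∀ g, toIsom.comp (V.iso g) = (W.iso g).comp toIsom

/-- Composition of equivariant linear isometric embeddings. -/
def Emb.trans {V₁ V₂ V₃ : OrthRep Γ} (i : V₁.Emb V₂) (j : V₂.Emb V₃) : V₁.Emb V₃ where
  toIsom := j.toIsom.comp i.toIsom
  equivariant g := by
    rw [LinearIsometry.comp_assoc, i.equivariant, ← LinearIsometry.comp_assoc, j.equivariant,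
      LinearIsometry.comp_assoc]

/-- The direct sum of an equivariant embedding with an identity map. -/
def Emb.sum {V₁ V₂ : OrthRep Γ} (i : V₁.Emb V₂) (W : OrthRep Γ) : (V₁.sum W).Emb (V₂.sum W) where
  toIsom := LinearIsometry.withLpProdMap 2 i.toIsom LinearIsometry.id
  equivariant g := by
    refine LinearIsometry.ext fun (x : WithLp 2 (V₁.carrier × W.carrier)) => ?_
    exact congrArg (fun y => WithLp.toLp 2 (y, W.act g x.snd))
      (congrArg (fun f : V₁.carrier →ₗᵢ[ℝ] V₂.carrier => f x.fst) (i.equivariant g))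

end OrthRep

/-- A pointed topological space with an action of a (discrete) group by pointed homeomorphisms. -/
structure GSpace (Γ : Type u) [Group Γ] where
  /-- The underlying set. -/
  carrier : Type (u + 1)
  [top : TopologicalSpace carrier]
  [action : MulAction Γ carrier]
  [cts : ContinuousConstSMul Γ carrier]
  /-- The base point. -/
  pt : carrier
  smul_pt : ∀ g : Γ, g • pt = pt

attribute [instance] GSpace.top GSpace.action GSpace.cts

/-! ### Equivariant Weiss functors -/

/-- The element `g` defines a morphism `G/K → G/H`, `x K ↦ x g H`, of the orbit category. -/
def ConjLE {G : Type u} [Group G] (K H : Subgroup G) (g : G) : Prop :=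
  ∀ k ∈ K, g⁻¹ * k * g ∈ H

/-- The homomorphism `K → H`, `k ↦ g⁻¹ k g`. -/
def conjHom {G : Type u} [Group G] {K H : Subgroup G} {g : G} (hg : ConjLE K H g) : K →* H where
  toFun k := ⟨g⁻¹ * (k : G) * g, hg _ k.2⟩
  map_one' := Subtype.ext (by simp)
  map_mul' a b := Subtype.ext (by simp [mul_assoc])

lemma ConjLE.mul {G : Type u} [Group G] {L K H : Subgroup G} {g g₁ : G} (h₁ : ConjLE L K g₁)
    (h : ConjLE K H g) : ConjLE L H (g₁ * g) := fun l hl => by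
  have := h _ (h₁ l hl)
  simpa [mul_assoc] using this

lemma ConjLE.self {G : Type u} [Group G] {H : Subgroup G} (h : H) : ConjLE H H (h : G) :=
  fun _ hk => H.mul_mem (H.mul_mem (H.inv_mem h.2) hk) h.2

/-- A `G`-equivariant Weiss functor: a morphism from the presheaf
`G/H ↦ {orthogonal representations of H}` to the presheaf `G/H ↦ {pointed H-spaces}` on the orbit
category of `G`.  It consists of continuous `H`-functors, one for every subgroup `H`: the space of
morphisms from `V` to `W` is the `H`-space of all linear isometric embeddings, on which `H` acts by
conjugation, and likewise all pointed maps are morphisms of pointed `H`-spaces.  These functors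
commute, up to coherent natural isomorphism, with restriction along all morphisms of the orbit
category.  A morphism `G/K → G/H` is represented by elements `g` with `g⁻¹ K g ⊆ H`, restriction
is along `k ↦ g⁻¹ k g`, and two representatives `g`, `g h` with `h ∈ H` are identified through
the action of `h`. -/
structure WeissFunctor (G : Type u) [Group G] where
  /-- The value at `G/H` on an `H`-representation. -/
  obj : ∀ {H : Subgroup G}, OrthRep H → GSpace H
  /-- The action of linear isometric embeddings, not necessarily equivariant. -/
  map : ∀ {H : Subgroup G} (V W : OrthRep H), (V.carrier →ₗᵢ[ℝ] W.carrier) →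
    (obj V).carrier → (obj W).carrier
  map_id : ∀ {H : Subgroup G} (V : OrthRep H) (x : (obj V).carrier),
    map V V LinearIsometry.id x = x
  map_comp : ∀ {H : Subgroup G} (U V W : OrthRep H) (f : U.carrier →ₗᵢ[ℝ] V.carrier)
    (g : V.carrier →ₗᵢ[ℝ] W.carrier) (x : (obj U).carrier),
    map U W (g.comp f) x = map V W g (map U V f x)
  map_pt : ∀ {H : Subgroup G} (V W : OrthRep H) (f : V.carrier →ₗᵢ[ℝ] W.carrier),
    map V W f (obj V).pt = (obj W).pt
  map_continuous : ∀ {H : Subgroup G} (V W : OrthRep H),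
    Continuous fun p : (V.carrier →ₗᵢ[ℝ] W.carrier) × (obj V).carrier => map V W p.1 p.2
  map_smul : ∀ {H : Subgroup G} (V W : OrthRep H) (h : H) (f : V.carrier →ₗᵢ[ℝ] W.carrier)
    (x : (obj V).carrier), map V W (OrthRep.conj h f) (h • x) = h • map V W f x
  /-- The comparison with restriction along `G/K → G/H`. -/
  res : ∀ {K H : Subgroup G} {g : G} (hg : ConjLE K H g) (W : OrthRep H),
    (obj (W.res (conjHom hg))).carrier ≃ₜ (obj W).carrier
  res_pt : ∀ {K H : Subgroup G} {g : G} (hg : ConjLE K H g) (W : OrthRep H),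
    res hg W (obj (W.res (conjHom hg))).pt = (obj W).pt
  res_smul : ∀ {K H : Subgroup G} {g : G} (hg : ConjLE K H g) (W : OrthRep H) (k : K)
    (x : (obj (W.res (conjHom hg))).carrier), res hg W (k • x) = conjHom hg k • res hg W x
  res_map : ∀ {K H : Subgroup G} {g : G} (hg : ConjLE K H g) (V W : OrthRep H)
    (f : V.carrier →ₗᵢ[ℝ] W.carrier) (x : (obj (V.res (conjHom hg))).carrier),
    res hg W (map (V.res (conjHom hg)) (W.res (conjHom hg)) f x) = map V W f (res hg V x)
  res_mul : ∀ {L K H : Subgroup G} {g₁ g : G} (h₁ : ConjLE L K g₁) (hg : ConjLE K H g)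
    (W : OrthRep H) (x : (obj ((W.res (conjHom hg)).res (conjHom h₁))).carrier),
    res hg W (res h₁ (W.res (conjHom hg)) x) =
      res (h₁.mul hg) W (map ((W.res (conjHom hg)).res (conjHom h₁))
        (W.res (conjHom (h₁.mul hg))) LinearIsometry.id x)
  res_inner : ∀ {H : Subgroup G} (h : H) (W : OrthRep H)
    (x : (obj (W.res (conjHom (ConjLE.self h)))).carrier),
    h • res (ConjLE.self h) W x = map (W.res (conjHom (ConjLE.self h))) W (W.iso h) x

namespace WeissFunctor

variable {G : Type u} [Group G]

/-- A 2-morphism of equivariant Weiss functors: pointed equivariant maps, natural with respect to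
all linear isometric embeddings and compatible with restriction along the orbit category. -/
@[ext]
structure Hom (E F : WeissFunctor G) where
  /-- The component at an `H`-representation. -/
  app : ∀ {H : Subgroup G} (V : OrthRep H), (E.obj V).carrier → (F.obj V).carrier
  app_continuous : ∀ {H : Subgroup G} (V : OrthRep H), Continuous (app V)
  app_pt : ∀ {H : Subgroup G} (V : OrthRep H), app V (E.obj V).pt = (F.obj V).pt
  app_smul : ∀ {H : Subgroup G} (V : OrthRep H) (h : H) (x : (E.obj V).carrier),
    app V (h • x) = h • app V x
  app_map : ∀ {H : Subgroup G} (V W : OrthRep H) (f : V.carrier →ₗᵢ[ℝ] W.carrier)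
    (x : (E.obj V).carrier), app W (E.map V W f x) = F.map V W f (app V x)
  app_res : ∀ {K H : Subgroup G} {g : G} (hg : ConjLE K H g) (W : OrthRep H)
    (x : (E.obj (W.res (conjHom hg))).carrier),
    app W (E.res hg W x) = F.res hg W (app (W.res (conjHom hg)) x)

instance : CategoryTheory.Category (WeissFunctor G) where
  Hom := Hom
  id E :=
    { app := fun _ x => x
      app_continuous := fun _ => continuous_id
      app_pt := fun _ => rfl
      app_smul := fun _ _ _ => rfl
      app_map := fun _ _ _ _ => rfl
      app_res := fun _ _ _ => rfl }
  comp φ ψ :=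
    { app := fun V x => ψ.app V (φ.app V x)
      app_continuous := fun V => (ψ.app_continuous V).comp (φ.app_continuous V)
      app_pt := fun V => by rw [φ.app_pt, ψ.app_pt]
      app_smul := fun V h x => by rw [φ.app_smul, ψ.app_smul]
      app_map := fun V W f x => by rw [φ.app_map, ψ.app_map]
      app_res := fun hg W x => by rw [φ.app_res, ψ.app_res] }

/-! ### The functor `τ` -/

/-- The homotopy limit of `Ê(W ⊕ U)` over the topological poset of nonzero subspaces `U` of `A`,
where `Ê` is the right Kan extension of `E` from representations to vector spaces, so that
a point of `Ê(X)` is a continuous natural family of maps `{isometric embeddings X → V} → E(V)`,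
indexed by the `H`-representations `V`.  The homotopy limit is the totalization of the cosimplicial
space of (continuous) sections of `(U₀ ≤ ⋯ ≤ Uₙ) ↦ Ê(W ⊕ Uₙ)` over the space of flags; its points
are compatible maps from the standard simplices to these spaces of sections. -/
@[ext]
structure HoLim (E : WeissFunctor G) {H : Subgroup G} (W : OrthRep H) (A : Type u)
    [NormedAddCommGroup A] [InnerProductSpace ℝ A] [FiniteDimensional ℝ A] where
  /-- The value at a point `t` of the `n`-simplex, a flag `U₀ ≤ ⋯ ≤ Uₙ`, and an isometric embedding
  `W ⊕ Uₙ → V`. -/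
  val : ∀ (n : ℕ) (V : OrthRep H),
    C(stdSimplex ℝ (Fin (n + 1)) × Cell A W.carrier V.carrier n, (E.obj V).carrier)
  /-- For fixed `t` and `U₀ ≤ ⋯ ≤ Uₙ` the value is a point of the Kan extension. -/
  nat : ∀ (n : ℕ) (V V₁ : OrthRep H) (v : V.carrier →ₗᵢ[ℝ] V₁.carrier)
    (t : stdSimplex ℝ (Fin (n + 1))) (c : Cell A W.carrier V.carrier n),
    val n V₁ (t, c.trans LinearIsometry.id LinearIsometry.id v) = E.map V V₁ v (val n V (t, c))
  /-- Compatibility with the cosimplicial structures. -/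
  tot : ∀ (m n : ℕ) (σ : Fin (m + 1) →o Fin (n + 1)) (V : OrthRep H)
    (t : stdSimplex ℝ (Fin (m + 1))) (c : Cell A W.carrier V.carrier n),
    val n V (stdSimplex.map σ t, c) = val m V (t, c.pull σ)

namespace HoLim

variable {E E₁ : WeissFunctor G} {H H₁ : Subgroup G} {W : OrthRep H} {W₁ : OrthRep H₁}
  {A A₁ : Type u} [NormedAddCommGroup A] [InnerProductSpace ℝ A] [FiniteDimensional ℝ A]
  [NormedAddCommGroup A₁] [InnerProductSpace ℝ A₁] [FiniteDimensional ℝ A₁]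

/-- The topology of the homotopy limit, from the compact-open topologies. -/
instance : TopologicalSpace (HoLim E W A) := TopologicalSpace.induced HoLim.val inferInstance

lemma ext_val {Φ Ψ : HoLim E W A} (h : ∀ n V t c, Φ.val n V (t, c) = Ψ.val n V (t, c)) : Φ = Ψ :=
  HoLim.ext (funext fun n => funext fun V => ContinuousMap.ext fun p => h n V p.1 p.2)

/-- A general construction of maps between homotopy limits. -/
def push (star : OrthRep H₁ → OrthRep H)
    (F : ∀ V : OrthRep H₁, (E.obj (star V)).carrier → (E₁.obj V).carrier)
    (hF : ∀ V, Continuous (F V)) (i : A₁ →ₗᵢ[ℝ] A) (w : W.carrier →ₗᵢ[ℝ] W₁.carrier)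
    (v : ∀ V : OrthRep H₁, V.carrier →ₗᵢ[ℝ] (star V).carrier)
    (hv : ∀ (V V₁ : OrthRep H₁) (f : V.carrier →ₗᵢ[ℝ] V₁.carrier),
      ∃ f₁ : (star V).carrier →ₗᵢ[ℝ] (star V₁).carrier, f₁.comp (v V) = (v V₁).comp f ∧
        ∀ x, F V₁ (E.map _ _ f₁ x) = E₁.map V V₁ f (F V x))
    (Φ : HoLim E W A) : HoLim E₁ W₁ A₁ where
  val n V := ⟨fun p => F V (Φ.val n (star V) (p.1, p.2.trans i w (v V))),
    (hF V).comp ((Φ.val n (star V)).continuous.comp (continuous_fst.prodMk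
      (Cell.continuous_trans i continuous_const (v V) continuous_snd)))⟩
  nat n V V₁ f t c := by
    obtain ⟨f₁, h₁, h₂⟩ := hv V V₁ f
    change F V₁ (Φ.val n (star V₁) (t, _)) = E₁.map V V₁ f (F V (Φ.val n (star V) (t, _)))
    rw [← h₂, ← Φ.nat, Cell.trans_trans, Cell.trans_trans, h₁]
    rfl
  tot m n σ V t c := by
    change F V (Φ.val n (star V) (_, _)) = F V (Φ.val m (star V) (_, _))
    rw [Φ.tot, Cell.trans_pull]

lemma continuous_push {X : Type*} [TopologicalSpace X] (star : OrthRep H₁ → OrthRep H)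
    (F : ∀ V : OrthRep H₁, (E.obj (star V)).carrier → (E₁.obj V).carrier)
    (hF : ∀ V, Continuous (F V)) (i : A₁ →ₗᵢ[ℝ] A) {w : X → W.carrier →ₗᵢ[ℝ] W₁.carrier}
    (hw : Continuous w)
    (v : ∀ V : OrthRep H₁, V.carrier →ₗᵢ[ℝ] (star V).carrier)
    (hv : ∀ (V V₁ : OrthRep H₁) (f : V.carrier →ₗᵢ[ℝ] V₁.carrier),
      ∃ f₁ : (star V).carrier →ₗᵢ[ℝ] (star V₁).carrier, f₁.comp (v V) = (v V₁).comp f ∧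
        ∀ x, F V₁ (E.map _ _ f₁ x) = E₁.map V V₁ f (F V x))
    {Φ : X → HoLim E W A} (hΦ : Continuous Φ) :
    Continuous fun x => push (W₁ := W₁) star F hF i (w x) v hv (Φ x) := by
  refine continuous_induced_rng.2 (continuous_pi fun n => continuous_pi fun V => ?_)
  refine ContinuousMap.continuous_of_continuous_uncurry _ ?_
  have h1 : Continuous fun x => (Φ x).val n (star V) :=
    (continuous_apply (star V)).comp ((continuous_apply n).comp (continuous_induced_dom.comp hΦ))
  refine (hF V).comp ?_
  exact (h1.comp continuous_fst).eval ((continuous_fst.comp continuous_snd).prodMk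
    (Cell.continuous_trans i (hw.comp continuous_fst) (v V) (continuous_snd.comp continuous_snd)))

end HoLim

namespace HoLim

variable {E : WeissFunctor G} {H : Subgroup G} {W : OrthRep H}

lemma conj_aux (h : H) (V V₁ : OrthRep H) (f : V.carrier →ₗᵢ[ℝ] V₁.carrier) :
    ∃ f₁ : V.carrier →ₗᵢ[ℝ] V₁.carrier, f₁.comp (V.iso h⁻¹) = (V₁.iso h⁻¹).comp f ∧
      ∀ x, h • E.map V V₁ f₁ x = E.map V V₁ f (h • x) := by
  refine ⟨OrthRep.conj h⁻¹ f, ?_, fun x => ?_⟩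
  · rw [OrthRep.conj, LinearIsometry.comp_assoc, LinearIsometry.comp_assoc, ← OrthRep.iso_mul]
    simp [OrthRep.iso_one]
  · rw [← E.map_smul]
    congr 1
    rw [OrthRep.conj, OrthRep.conj, inv_inv, LinearIsometry.comp_assoc,
      LinearIsometry.comp_assoc, ← OrthRep.iso_mul, ← LinearIsometry.comp_assoc,
      ← OrthRep.iso_mul]
    simp [OrthRep.iso_one]

/-- The action of `h : H` on the homotopy limit, by
`(h • Φ)(U₀ ≤ ⋯ ≤ Uₙ) = h • Φ(h⁻¹ U₀ ≤ ⋯ ≤ h⁻¹ Uₙ)`, where `h : Ê(h⁻¹ X) → Ê(X)` is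
`(h • φ)(f) = h • φ(h⁻¹ f h)`. -/
def actBy (α : OrthRep G) (h : H) (Φ : HoLim E W α.carrier) : HoLim E W α.carrier :=
  push (fun V => V) (fun _ x => h • x) (fun _ => continuous_const_smul h) (α.iso (h : G)⁻¹)
    (W.iso h) (fun V => V.iso h⁻¹) (conj_aux h) Φ

lemma continuous_actBy (α : OrthRep G) (h : H) :
    Continuous (actBy α h : HoLim E W α.carrier → HoLim E W α.carrier) :=
  continuous_push (fun V => V) (fun _ x => h • x) (fun _ => continuous_const_smul h)
    (α.iso (h : G)⁻¹) continuous_const (fun V => V.iso h⁻¹) (conj_aux h) continuous_id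

/-- Functoriality of the homotopy limit in `W`: precomposition of isometric embeddings. -/
def mapBy {A : Type u} [NormedAddCommGroup A] [InnerProductSpace ℝ A] [FiniteDimensional ℝ A]
    {W₁ : OrthRep H} (w : W.carrier →ₗᵢ[ℝ] W₁.carrier) (Φ : HoLim E W A) : HoLim E W₁ A :=
  push (fun V => V) (fun _ x => x) (fun _ => continuous_id) LinearIsometry.id w
    (fun _ => LinearIsometry.id) (fun _ _ f => ⟨f, rfl, fun _ => rfl⟩) Φ

/-- The base point of the homotopy limit. -/
def base (E : WeissFunctor G) (W : OrthRep H) (A : Type u) [NormedAddCommGroup A]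
    [InnerProductSpace ℝ A] [FiniteDimensional ℝ A] : HoLim E W A where
  val _ V := ⟨fun _ => (E.obj V).pt, continuous_const⟩
  nat _ V V₁ v _ _ := (E.map_pt V V₁ v).symm
  tot _ _ _ _ _ _ := rfl

/-- The action of `G` on the subspaces of a `G`-representation allows restriction along
`G/K → G/H`. -/
def resBy (α : OrthRep G) {K : Subgroup G} {g : G} (hg : ConjLE K H g)
    (Φ : HoLim E (W.res (conjHom hg)) α.carrier) : HoLim E W α.carrier :=
  push (W₁ := W) (fun V => V.res (conjHom hg)) (fun V => E.res hg V)
    (fun V => (E.res hg V).continuous) (α.iso g) LinearIsometry.id (fun _ => LinearIsometry.id)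
    (fun V V₁ f => ⟨f, rfl, fun x => E.res_map hg V V₁ f x⟩) Φ

lemma res_symm_map {K : Subgroup G} {g : G} (hg : ConjLE K H g) (V V₁ : OrthRep H)
    (f : V.carrier →ₗᵢ[ℝ] V₁.carrier) (x : (E.obj V).carrier) :
    (E.res hg V₁).symm (E.map V V₁ f x) =
      E.map (V.res (conjHom hg)) (V₁.res (conjHom hg)) f ((E.res hg V).symm x) := by
  rw [Homeomorph.symm_apply_eq, E.res_map, Homeomorph.apply_symm_apply]

/-- The inverse of `resBy`. -/
def resInvBy (α : OrthRep G) {K : Subgroup G} {g : G} (hg : ConjLE K H g)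
    (Φ : HoLim E W α.carrier) : HoLim E (W.res (conjHom hg)) α.carrier :=
  push (W₁ := W.res (conjHom hg)) (fun V => V.trivial H)
    (fun V x => E.map ((V.trivial H).res (conjHom hg)) V LinearIsometry.id
      ((E.res hg (V.trivial H)).symm x))
    (fun V => (E.map_continuous _ _).comp
      (continuous_const.prodMk (E.res hg (V.trivial H)).symm.continuous))
    (α.iso g⁻¹) LinearIsometry.id (fun _ => LinearIsometry.id)
    (fun V V₁ f => ⟨f, rfl, fun x => by
      rw [res_symm_map hg (V.trivial H) (V₁.trivial H) f, ← E.map_comp, ← E.map_comp]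
      rfl⟩) Φ

end HoLim

instance (α : OrthRep G) (E : WeissFunctor G) {H : Subgroup G} (W : OrthRep H) :
    MulAction H (HoLim E W α.carrier) where
  smul h Φ := HoLim.actBy α h Φ
  one_smul Φ := HoLim.ext_val fun n V t c => by
    change (1 : H) • Φ.val n V (t, c.trans (α.iso ((1 : H) : G)⁻¹) (W.iso 1) (V.iso 1⁻¹)) = _
    simp [OrthRep.iso_one, Cell.trans_id]
  mul_smul g h Φ := HoLim.ext_val fun n V t c => by
    change (g * h) • Φ.val n V (t, c.trans (α.iso ((g * h : H) : G)⁻¹) (W.iso (g * h))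
      (V.iso (g * h)⁻¹)) = g • h • Φ.val n V (t, (c.trans (α.iso (g : G)⁻¹) (W.iso g)
      (V.iso g⁻¹)).trans (α.iso (h : G)⁻¹) (W.iso h) (V.iso h⁻¹))
    rw [Cell.trans_trans, mul_smul, ← OrthRep.iso_mul, ← OrthRep.iso_mul,
      ← OrthRep.iso_mul, mul_inv_rev, Subgroup.coe_mul, mul_inv_rev]

/-- The pointed `H`-space `holim_U Ê(W ⊕ U)`, where `U` runs over the nonzero subspaces of `α`. -/
abbrev tauObj (α : OrthRep G) (E : WeissFunctor G) {H : Subgroup G} (W : OrthRep H) : GSpace H where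
  carrier := HoLim E W α.carrier
  cts := ⟨HoLim.continuous_actBy α⟩
  pt := HoLim.base E W α.carrier
  smul_pt := fun h => HoLim.ext_val fun _ V _ _ => (E.obj V).smul_pt h

/-- The comparison of `τ_α E` with restriction along `G/K → G/H`. -/
def tauRes (α : OrthRep G) (E : WeissFunctor G) {K H : Subgroup G} {g : G} (hg : ConjLE K H g)
    (W : OrthRep H) : HoLim E (W.res (conjHom hg)) α.carrier ≃ₜ HoLim E W α.carrier where
  toFun := HoLim.resBy α hg
  invFun := HoLim.resInvBy α hg
  left_inv := fun Φ => HoLim.ext_val fun n V t c => by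
    change E.map ((V.trivial _).res (conjHom hg)) V LinearIsometry.id
      ((E.res hg (V.trivial _)).symm (E.res hg (V.trivial _)
        (Φ.val n ((V.trivial _).res (conjHom hg))
          (t, Cell.trans _ _ _ (Cell.trans _ _ _ c))))) = _
    rw [Homeomorph.symm_apply_apply, ← Φ.nat, Cell.trans_trans, Cell.trans_trans,
      LinearIsometry.id_comp, ← OrthRep.iso_mul, mul_inv_cancel, OrthRep.iso_one]
    exact congrArg (fun d => Φ.val n V (t, d)) c.trans_id
  right_inv := fun Φ => HoLim.ext_val fun n V t c => by
    change E.res hg V (E.map (((V.res (conjHom hg)).trivial _).res (conjHom hg))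
      (V.res (conjHom hg)) LinearIsometry.id
      ((E.res hg ((V.res (conjHom hg)).trivial _)).symm
        (Φ.val n ((V.res (conjHom hg)).trivial _)
          (t, Cell.trans _ _ _ (Cell.trans _ _ _ c))))) = _
    rw [E.res_map hg ((V.res (conjHom hg)).trivial _) V LinearIsometry.id,
      Homeomorph.apply_symm_apply, ← Φ.nat, Cell.trans_trans, Cell.trans_trans,
      LinearIsometry.id_comp, ← OrthRep.iso_mul, inv_mul_cancel, OrthRep.iso_one]
    exact congrArg (fun d => Φ.val n V (t, d)) c.trans_id
  continuous_toFun := HoLim.continuous_push _ _ _ _ continuous_const _ _ continuous_id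
  continuous_invFun := HoLim.continuous_push _ _ _ _ continuous_const _ _ continuous_id

/-- The functor `τ_α E`, with `(τ_α E)(W) = holim_U Ê(W ⊕ U)`, where `U` runs over the nonzero
subspaces of `α`. -/
def tau (α : OrthRep G) (E : WeissFunctor G) : WeissFunctor G where
  obj W := tauObj α E W
  map V W f Φ := HoLim.mapBy f Φ
  map_id V Φ := HoLim.ext_val fun n V t c => congrArg (fun d => Φ.val n V (t, d)) c.trans_id
  map_comp U V W f g Φ := HoLim.ext_val fun n X t c => by
    change Φ.val n X (t, _) = Φ.val n X (t, Cell.trans _ _ _ (Cell.trans _ _ _ c))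
    rw [Cell.trans_trans]
    rfl
  map_pt V W f := HoLim.ext_val fun n X t c => rfl
  map_continuous V W := HoLim.continuous_push _ _ _ _ continuous_fst _ _ continuous_snd
  map_smul V W h f Φ := HoLim.ext_val fun n X t c => by
    change h • Φ.val n X (t, Cell.trans _ _ _ (Cell.trans _ _ _ c)) =
      h • Φ.val n X (t, Cell.trans _ _ _ (Cell.trans _ _ _ c))
    rw [Cell.trans_trans, Cell.trans_trans]
    congr 4
    rw [OrthRep.conj, LinearIsometry.comp_assoc, LinearIsometry.comp_assoc, ← OrthRep.iso_mul]
    simp [OrthRep.iso_one]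
  res hg W := tauRes α E hg W
  res_pt hg W := HoLim.ext_val fun n V t c => E.res_pt hg V
  res_smul {K H g} hg W k Φ := HoLim.ext_val fun n V t c => by
    change E.res hg V (k • Φ.val n (V.res (conjHom hg))
        (t, Cell.trans _ _ _ (Cell.trans _ _ _ c))) =
      conjHom hg k • E.res hg V (Φ.val n (V.res (conjHom hg))
        (t, Cell.trans _ _ _ (Cell.trans _ _ _ c)))
    rw [E.res_smul, Cell.trans_trans, Cell.trans_trans, ← OrthRep.iso_mul, ← OrthRep.iso_mul]
    have e : ((k : G)⁻¹ * g) = g * ((conjHom hg k : H) : G)⁻¹ := by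
      simp [conjHom, mul_assoc]
    have e₁ : (V.res (conjHom hg)).iso k⁻¹ = V.iso (conjHom hg k)⁻¹ := by
      rw [OrthRep.iso_res, map_inv]
    rw [e]
    beta_reduce
    rw [e₁]
    rfl
  res_map hg V W f Φ := HoLim.ext_val fun n X t c => by
    change E.res hg X (Φ.val n (X.res (conjHom hg))
        (t, Cell.trans _ _ _ (Cell.trans _ _ _ c))) =
      E.res hg X (Φ.val n (X.res (conjHom hg)) (t, Cell.trans _ _ _ (Cell.trans _ _ _ c)))
    rw [Cell.trans_trans, Cell.trans_trans]
    rfl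
  res_mul h₁ hg W Φ := HoLim.ext_val fun n V t c => by
    change E.res hg V (E.res h₁ (V.res (conjHom hg))
        (Φ.val n ((V.res (conjHom hg)).res (conjHom h₁))
          (t, Cell.trans _ _ _ (Cell.trans _ _ _ c)))) =
      E.res (h₁.mul hg) V (Φ.val n (V.res (conjHom (h₁.mul hg)))
        (t, Cell.trans _ _ _ (Cell.trans _ _ _ c)))
    rw [E.res_mul, ← Φ.nat, Cell.trans_trans, Cell.trans_trans, Cell.trans_trans,
      LinearIsometry.id_comp, ← OrthRep.iso_mul]
    rfl
  res_inner {H} h W Φ := HoLim.ext_val fun n V t c => by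
    change h • E.res (ConjLE.self h) V (Φ.val n (V.res (conjHom (ConjLE.self h)))
        (t, Cell.trans _ _ _ (Cell.trans _ _ _ c))) = Φ.val n V (t, c.trans _ _ _)
    rw [E.res_inner, ← Φ.nat, Cell.trans_trans, Cell.trans_trans, LinearIsometry.id_comp,
      ← OrthRep.iso_mul, mul_inv_cancel, OrthRep.iso_one]
    congr 3
    change ((V.iso h).comp (LinearIsometry.id.comp (V.iso h⁻¹))) = _
    rw [LinearIsometry.id_comp, ← OrthRep.iso_mul, mul_inv_cancel, OrthRep.iso_one]

/-- The natural map `η : E → τ_α E`: the point `x` of `E(W)` goes to the constant family of its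
images under the inclusions `W → W ⊕ Uₙ`. -/
def tauUnit (α : OrthRep G) (E : WeissFunctor G) : E ⟶ tau α E where
  app {H} W x :=
    ({ val := fun n V => ⟨fun p => E.map W V p.2.base x,
          (E.map_continuous W V).comp
            ((Cell.continuous_base.comp continuous_snd).prodMk continuous_const)⟩
       nat := fun n V V₁ v t c => E.map_comp W V V₁ c.base v x
       tot := fun m n σ V t c => rfl } : HoLim E W α.carrier)
  app_continuous {H} W := by
    refine continuous_induced_rng.2 (continuous_pi fun n => continuous_pi fun V => ?_)
    refine ContinuousMap.continuous_of_continuous_uncurry _ ?_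
    exact (E.map_continuous W V).comp ((Cell.continuous_base.comp
      (continuous_snd.comp continuous_snd)).prodMk continuous_fst)
  app_pt W := HoLim.ext_val fun n V t c => E.map_pt W V c.base
  app_smul W h x := HoLim.ext_val fun n V t c => by
    change E.map W V c.base (h • x) = h • E.map W V (c.trans _ _ _).base x
    rw [← E.map_smul, Cell.base_trans, OrthRep.conj, LinearIsometry.comp_assoc,
      LinearIsometry.comp_assoc, ← OrthRep.iso_mul, ← LinearIsometry.comp_assoc,
      ← OrthRep.iso_mul]
    simp [OrthRep.iso_one]
  app_map W W₁ f x := HoLim.ext_val fun n V t c => by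
    change E.map W₁ V c.base (E.map W W₁ f x) = E.map W V (c.trans _ _ _).base x
    rw [← E.map_comp]
    rfl
  app_res hg W x := HoLim.ext_val fun n V t c => by
    change E.map W V c.base (E.res hg W x) = E.res hg V (E.map (W.res (conjHom hg))
      (V.res (conjHom hg)) (c.trans _ _ _).base x)
    rw [← E.res_map]
    rfl

/-- The functor `τ_α` on 2-morphisms. -/
def tauMap (α : OrthRep G) {E F : WeissFunctor G} (φ : E ⟶ F) : tau α E ⟶ tau α F where
  app {H} W Φ :=
    ({ val := fun n V => ⟨fun p => Hom.app φ V (HoLim.val Φ n V p),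
          (Hom.app_continuous φ V).comp (HoLim.val Φ n V).continuous⟩
       nat := fun n V V₁ v t c =>
         (congrArg (Hom.app φ V₁) (HoLim.nat Φ n V V₁ v t c)).trans (Hom.app_map φ V V₁ v _)
       tot := fun m n σ V t c => congrArg (Hom.app φ V) (HoLim.tot Φ m n σ V t c) } :
      HoLim F W α.carrier)
  app_continuous {H} W := by
    refine continuous_induced_rng.2 (continuous_pi fun n => continuous_pi fun V => ?_)
    have h1 : Continuous fun Φ : HoLim E W α.carrier => Φ.val n V :=
      (continuous_apply V).comp ((continuous_apply n).comp continuous_induced_dom)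
    exact (ContinuousMap.continuous_postcomp ⟨Hom.app φ V, Hom.app_continuous φ V⟩).comp h1
  app_pt W := HoLim.ext_val fun n V t c => Hom.app_pt φ V
  app_smul W h Φ := HoLim.ext_val fun n V t c => Hom.app_smul φ V h _
  app_map W W₁ f Φ := HoLim.ext_val fun n V t c => rfl
  app_res hg W Φ := HoLim.ext_val fun n V t c => Hom.app_res φ hg V _

/-- The natural map `τ_α E → τ_{α₁} E` for `α₁ ⊆ α`: restriction of the homotopy limit to the
subspaces of `α` which are contained in `α₁`. -/
def tauRestrict {α₁ α : OrthRep G} (i : α₁.Emb α) (E : WeissFunctor G) : tau α E ⟶ tau α₁ E where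
  app {H} W Φ := HoLim.push (E := E) (E₁ := E) (W := W) (W₁ := W) (fun V => V) (fun _ x => x)
    (fun _ => continuous_id) i.toIsom LinearIsometry.id (fun _ => LinearIsometry.id)
    (fun _ _ f => ⟨f, rfl, fun _ => rfl⟩) Φ
  app_continuous {H} W :=
    HoLim.continuous_push _ _ _ _ continuous_const _ _ continuous_id
  app_pt W := rfl
  app_smul {H} W h Φ := HoLim.ext_val fun n V t c => by
    change h • HoLim.val Φ n V (t, Cell.trans _ _ _ (Cell.trans _ _ _ c)) =
      h • HoLim.val Φ n V (t, Cell.trans _ _ _ (Cell.trans _ _ _ c))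
    rw [Cell.trans_trans, Cell.trans_trans, i.equivariant]
    rfl
  app_map W W₁ f Φ := HoLim.ext_val fun n V t c => by
    change HoLim.val Φ n V (t, Cell.trans _ _ _ (Cell.trans _ _ _ c)) =
      HoLim.val Φ n V (t, Cell.trans _ _ _ (Cell.trans _ _ _ c))
    rw [Cell.trans_trans, Cell.trans_trans]
    rfl
  app_res hg W Φ := HoLim.ext_val fun n V t c => by
    change E.res hg V (HoLim.val Φ n (V.res (conjHom hg))
        (t, Cell.trans _ _ _ (Cell.trans _ _ _ c))) =
      E.res hg V (HoLim.val Φ n (V.res (conjHom hg)) (t, Cell.trans _ _ _ (Cell.trans _ _ _ c)))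
    rw [Cell.trans_trans, Cell.trans_trans, i.equivariant]

/-- The iterates `τ_α^n E`, with `τ_α^{n+1} E = τ_α (τ_α^n E)`. -/
def tauIter (α : OrthRep G) (E : WeissFunctor G) : ℕ → WeissFunctor G
  | 0 => E
  | n + 1 => tau α (tauIter α E n)

/-- The maps `τ_α^n(η) : τ_α^n E → τ_α^{n+1} E`. -/
def tauIterStep (α : OrthRep G) (E : WeissFunctor G) :
    ∀ n, tauIter α E n ⟶ tauIter α E (n + 1)
  | 0 => tauUnit α E
  | n + 1 => tauMap α (tauIterStep α E n)

/-- The functors `τ_α^n` on 2-morphisms. -/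
def tauIterMap (α : OrthRep G) {E F : WeissFunctor G} (φ : E ⟶ F) :
    ∀ n, tauIter α E n ⟶ tauIter α F n
  | 0 => φ
  | n + 1 => tauMap α (tauIterMap α φ n)

/-- The natural map `τ_α^n E → τ_{α₁}^n E` for `α₁ ⊆ α`, which restricts all `n` homotopy
limits. -/
def tauIterRestrict {α₁ α : OrthRep G} (i : α₁.Emb α) (E : WeissFunctor G) :
    ∀ n, tauIter α E n ⟶ tauIter α₁ E n
  | 0 => CategoryTheory.CategoryStruct.id E
  | n + 1 => CategoryTheory.CategoryStruct.comp (tauRestrict i (tauIter α E n))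
      (tauMap α₁ (tauIterRestrict i E n))

end WeissFunctor

/-! ### Homotopy colimits of sequences -/

section Tel

universe v

variable {X Y Z : ℕ → Type v} [∀ n, TopologicalSpace (X n)] [∀ n, TopologicalSpace (Y n)]
  [∀ n, TopologicalSpace (Z n)]

/-- The identifications in the mapping telescope of a sequence of pointed spaces. -/
inductive TelRel (pt : ∀ n, X n) (j : ∀ n, X n → X (n + 1)) :
    (Σ n, X n × unitInterval) → (Σ n, X n × unitInterval) → Prop
  | glue (n : ℕ) (x : X n) : TelRel pt j ⟨n, x, 1⟩ ⟨n + 1, j n x, 0⟩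
  | base (n : ℕ) (s t : unitInterval) : TelRel pt j ⟨n, pt n, s⟩ ⟨n, pt n, t⟩

/-- The homotopy colimit of a sequence of pointed spaces: the reduced mapping telescope, that is,
the quotient of the disjoint union of the cylinders `X n × [0, 1]` in which `(x, 1)` in the
`n`-th cylinder is identified with `(j x, 0)` in the next one, and the line of base points is
collapsed. -/
def Tel (pt : ∀ n, X n) (j : ∀ n, X n → X (n + 1)) : Type v := Quot (TelRel pt j)

namespace Tel

variable {pt : ∀ n, X n} {j : ∀ n, X n → X (n + 1)} {pt₁ : ∀ n, Y n} {j₁ : ∀ n, Y n → Y (n + 1)}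

instance : TopologicalSpace (Tel pt j) :=
  inferInstanceAs (TopologicalSpace (Quot (TelRel pt j)))

/-- The point `(x, t)` of the `n`-th cylinder. -/
def mk (pt : ∀ n, X n) (j : ∀ n, X n → X (n + 1)) (n : ℕ) (x : X n) (t : unitInterval) :
    Tel pt j := Quot.mk _ ⟨n, x, t⟩

lemma ind {P : Tel pt j → Prop} (h : ∀ n x t, P (mk pt j n x t)) (z : Tel pt j) : P z :=
  Quot.ind (fun ⟨n, x, t⟩ => h n x t) z

lemma mk_glue (n : ℕ) (x : X n) : mk pt j n x 1 = mk pt j (n + 1) (j n x) 0 :=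
  Quot.sound (TelRel.glue n x)

lemma mk_base (n : ℕ) (s t : unitInterval) : mk pt j n (pt n) s = mk pt j n (pt n) t :=
  Quot.sound (TelRel.base n s t)

lemma continuous_mk (n : ℕ) : Continuous fun p : X n × unitInterval => mk pt j n p.1 p.2 :=
  continuous_quot_mk.comp (continuous_sigmaMk (σ := fun n => X n × unitInterval) (i := n))

/-- A map of telescopes induced by a map of sequences. -/
def map (f : ∀ n, X n → Y n) (hpt : ∀ n, f n (pt n) = pt₁ n)
    (hj : ∀ n x, f (n + 1) (j n x) = j₁ n (f n x)) : Tel pt j → Tel pt₁ j₁ :=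
  Quot.lift (fun p => mk pt₁ j₁ p.1 (f p.1 p.2.1) p.2.2) (by
    rintro _ _ (⟨n, x⟩ | ⟨n, s, t⟩)
    · exact (mk_glue n (f n x)).trans (congrArg (fun y => mk pt₁ j₁ (n + 1) y 0) (hj n x).symm)
    · simp only [hpt]
      exact mk_base n s t)

lemma continuous_map {P : Type*} [TopologicalSpace P] [LocallyCompactSpace P]
    (f : P → ∀ n, X n → Y n) (hpt : ∀ p n, f p n (pt n) = pt₁ n)
    (hj : ∀ p n x, f p (n + 1) (j n x) = j₁ n (f p n x))
    (hf : ∀ n, Continuous fun q : P × X n => f q.1 n q.2) :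
    Continuous fun q : P × Tel pt j =>
      map (pt₁ := pt₁) (j₁ := j₁) (f q.1) (hpt q.1) (hj q.1) q.2 := by
  have h0 : ∀ z : Tel pt j, Continuous fun p =>
      map (pt₁ := pt₁) (j₁ := j₁) (f p) (hpt p) (hj p) z :=
    ind fun n x t => (continuous_mk (pt := pt₁) (j := j₁) n).comp
      (((hf n).comp (continuous_id.prodMk continuous_const)).prodMk continuous_const)
  have h1 : Continuous fun z : Tel pt j => (⟨fun p =>
      map (pt₁ := pt₁) (j₁ := j₁) (f p) (hpt p) (hj p) z, h0 z⟩ : C(P, Tel pt₁ j₁)) := by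
    refine isQuotientMap_quot_mk.continuous_iff.2 (continuous_sigma fun n => ?_)
    refine ContinuousMap.continuous_of_continuous_uncurry _ ?_
    exact (continuous_mk (pt := pt₁) (j := j₁) n).comp (((hf n).comp (continuous_snd.prodMk
      (continuous_fst.comp continuous_fst))).prodMk (continuous_snd.comp continuous_fst))
  exact (h1.comp continuous_snd).eval continuous_fst

lemma continuous_map_single (f : ∀ n, X n → Y n) (hpt : ∀ n, f n (pt n) = pt₁ n)
    (hj : ∀ n x, f (n + 1) (j n x) = j₁ n (f n x)) (hf : ∀ n, Continuous (f n)) :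
    Continuous (map (pt₁ := pt₁) (j₁ := j₁) f hpt hj) :=
  (continuous_map (P := PUnit.{1}) (fun _ => f) (fun _ => hpt) (fun _ => hj)
    fun n => (hf n).comp continuous_snd).comp
      ((continuous_const (y := PUnit.unit.{1})).prodMk continuous_id)

end Tel

end Tel

lemma isometry_isClosedEmbedding {V W : Type*} [NormedAddCommGroup V] [InnerProductSpace ℝ V]
    [NormedAddCommGroup W] [InnerProductSpace ℝ W] : Topology.IsClosedEmbedding
      (LinearIsometry.toContinuousLinearMap : (V →ₗᵢ[ℝ] W) → V →L[ℝ] W) := by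
  refine ⟨⟨⟨rfl⟩, LinearIsometry.toContinuousLinearMap_injective⟩, ?_⟩
  have : Set.range (LinearIsometry.toContinuousLinearMap : (V →ₗᵢ[ℝ] W) → V →L[ℝ] W) =
      ⋂ v : V, {f | ‖f v‖ = ‖v‖} := by
    ext f
    simp only [Set.mem_iInter]
    constructor
    · rintro ⟨g, rfl⟩ v
      exact g.norm_map v
    · intro h
      exact ⟨⟨f.toLinearMap, h⟩, rfl⟩
  rw [this]
  exact isClosed_iInter fun v => isClosed_eq (continuous_id.clm_apply continuous_const).norm
    continuous_const

instance {V W : Type*} [NormedAddCommGroup V] [InnerProductSpace ℝ V] [FiniteDimensional ℝ V]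
    [NormedAddCommGroup W] [InnerProductSpace ℝ W] [FiniteDimensional ℝ W] :
    LocallyCompactSpace (V →ₗᵢ[ℝ] W) := by
  have : LocallyCompactSpace (V →L[ℝ] W) := inferInstance
  exact isometry_isClosedEmbedding.locallyCompactSpace

namespace WeissFunctor

variable {G : Type u} [Group G]

/-- The underlying set of the homotopy colimit of a sequence of equivariant Weiss functors. -/
abbrev hocolimSet (X : ℕ → WeissFunctor G) (j : ∀ n, X n ⟶ X (n + 1)) {H : Subgroup G}
    (W : OrthRep H) : Type (u + 1) :=
  Tel (fun n => ((X n).obj W).pt) (fun n => Hom.app (j n) W)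

instance (X : ℕ → WeissFunctor G) (j : ∀ n, X n ⟶ X (n + 1)) {H : Subgroup G} (W : OrthRep H) :
    MulAction H (hocolimSet X j W) where
  smul h := Tel.map (fun _ x => h • x) (fun n => ((X n).obj W).smul_pt h)
    (fun n x => (Hom.app_smul (j n) W h x).symm)
  one_smul := Tel.ind fun n x t => congrArg (fun y => Tel.mk _ _ n y t) (one_smul H x)
  mul_smul g h := Tel.ind fun n x t => congrArg (fun y => Tel.mk _ _ n y t) (mul_smul g h x)

/-- The pointed `H`-space underlying the homotopy colimit. -/
abbrev hocolimObj (X : ℕ → WeissFunctor G) (j : ∀ n, X n ⟶ X (n + 1)) {H : Subgroup G}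
    (W : OrthRep H) : GSpace H where
  carrier := hocolimSet X j W
  cts := ⟨fun h => Tel.continuous_map_single _ _ _ fun _ => continuous_const_smul h⟩
  pt := Tel.mk _ _ 0 ((X 0).obj W).pt 0
  smul_pt := fun h => congrArg (fun y => Tel.mk _ _ 0 y 0) (((X 0).obj W).smul_pt h)

/-- The objectwise homotopy colimit of a sequence of equivariant Weiss functors. -/
def hocolim (X : ℕ → WeissFunctor G) (j : ∀ n, X n ⟶ X (n + 1)) : WeissFunctor G where
  obj W := hocolimObj X j W
  map {H} V W f := Tel.map (fun n => (X n).map V W f) (fun n => (X n).map_pt V W f)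
    (fun n x => (Hom.app_map (j n) V W f x).symm)
  map_id V := Tel.ind fun n x t => congrArg (fun y => Tel.mk _ _ n y t) ((X n).map_id V x)
  map_comp U V W f g := Tel.ind fun n x t =>
    congrArg (fun y => Tel.mk _ _ n y t) ((X n).map_comp U V W f g x)
  map_pt V W f := congrArg (fun y => Tel.mk _ _ 0 y 0) ((X 0).map_pt V W f)
  map_continuous V W := Tel.continuous_map (fun f n => (X n).map V W f)
    (fun f n => (X n).map_pt V W f) (fun f n x => (Hom.app_map (j n) V W f x).symm)
    fun n => (X n).map_continuous V W
  map_smul V W h f := Tel.ind fun n x t =>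
    congrArg (fun y => Tel.mk _ _ n y t) ((X n).map_smul V W h f x)
  res {K H g} hg W :=
    { toFun := Tel.map (fun n => (X n).res hg W) (fun n => (X n).res_pt hg W)
        (fun n x => (Hom.app_res (j n) hg W x).symm)
      invFun := Tel.map (fun n => ((X n).res hg W).symm)
        (fun n => ((X n).res hg W).symm_apply_eq.2 ((X n).res_pt hg W).symm)
        (fun n x => ((X (n + 1)).res hg W).symm_apply_eq.2 (by
          rw [← Hom.app_res (j n) hg W, Homeomorph.apply_symm_apply]))
      left_inv := Tel.ind fun n x t =>
        congrArg (fun y => Tel.mk _ _ n y t) (((X n).res hg W).symm_apply_apply x)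
      right_inv := Tel.ind fun n x t =>
        congrArg (fun y => Tel.mk _ _ n y t) (((X n).res hg W).apply_symm_apply x)
      continuous_toFun := Tel.continuous_map_single _ _ _ fun n => ((X n).res hg W).continuous
      continuous_invFun :=
        Tel.continuous_map_single _ _ _ fun n => ((X n).res hg W).symm.continuous }
  res_pt hg W := congrArg (fun y => Tel.mk _ _ 0 y 0) ((X 0).res_pt hg W)
  res_smul hg W k := Tel.ind fun n x t =>
    congrArg (fun y => Tel.mk _ _ n y t) ((X n).res_smul hg W k x)
  res_map hg V W f := Tel.ind fun n x t =>
    congrArg (fun y => Tel.mk _ _ n y t) ((X n).res_map hg V W f x)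
  res_mul h₁ hg W := Tel.ind fun n x t =>
    congrArg (fun y => Tel.mk _ _ n y t) ((X n).res_mul h₁ hg W x)
  res_inner h W := Tel.ind fun n x t =>
    congrArg (fun y => Tel.mk _ _ n y t) ((X n).res_inner h W x)

/-- The map of homotopy colimits induced by a map of sequences. -/
def hocolimMap {X Y : ℕ → WeissFunctor G} {j : ∀ n, X n ⟶ X (n + 1)} {j₁ : ∀ n, Y n ⟶ Y (n + 1)}
    (φ : ∀ n, X n ⟶ Y n) (hφ : ∀ n, j n ≫ φ (n + 1) = φ n ≫ j₁ n) :
    hocolim X j ⟶ hocolim Y j₁ where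
  app W := (Tel.map (fun n => Hom.app (φ n) W) (fun n => Hom.app_pt (φ n) W)
    (fun n x => congrArg (fun ψ : Hom (X n) (Y (n + 1)) => ψ.app W x) (hφ n)) :
      hocolimSet X j W → hocolimSet Y j₁ W)
  app_continuous W := Tel.continuous_map_single _ _ _ fun n => Hom.app_continuous (φ n) W
  app_pt W := congrArg (fun y => Tel.mk _ _ 0 y 0) (Hom.app_pt (φ 0) W)
  app_smul W h := Tel.ind fun n x t =>
    congrArg (fun y => Tel.mk _ _ n y t) (Hom.app_smul (φ n) W h x)
  app_map V W f := Tel.ind fun n x t =>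
    congrArg (fun y => Tel.mk _ _ n y t) (Hom.app_map (φ n) V W f x)
  app_res hg W := Tel.ind fun n x t =>
    congrArg (fun y => Tel.mk _ _ n y t) (Hom.app_res (φ n) hg W x)

/-! ### Taylor approximations -/

/-- The `α`-th Taylor approximation of `E` in the direction of `ε`: the homotopy colimit of the
iterates of `τ_{α ⊕ ε}`. -/
def taylor (α ε : OrthRep G) (E : WeissFunctor G) : WeissFunctor G :=
  hocolim (tauIter (α.sum ε) E) (tauIterStep (α.sum ε) E)

/-- The point of the Taylor approximation which is given by a point of `τ_{α ⊕ ε}^n E` and a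
telescope coordinate `t`. -/
def taylorMk (α ε : OrthRep G) (E : WeissFunctor G) {H : Subgroup G} (W : OrthRep H) (n : ℕ)
    (x : ((tauIter (α.sum ε) E n).obj W).carrier) (t : unitInterval) :
    ((taylor α ε E).obj W).carrier :=
  (Tel.mk _ _ n x t : hocolimSet (tauIter (α.sum ε) E) (tauIterStep (α.sum ε) E) W)

lemma tauMap_comp (α : OrthRep G) {E F K : WeissFunctor G} (φ : E ⟶ F) (ψ : F ⟶ K) :
    tauMap α φ ≫ tauMap α ψ = tauMap α (φ ≫ ψ) := rfl

lemma tauUnit_naturality (α : OrthRep G) {E F : WeissFunctor G} (φ : E ⟶ F) :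
    tauUnit α E ≫ tauMap α φ = φ ≫ tauUnit α F :=
  Hom.ext (funext fun _ => funext fun _ => funext fun x => HoLim.ext_val fun _ V _ c =>
    Hom.app_map φ _ V c.base x)

lemma tauIterMap_naturality (α : OrthRep G) {E F : WeissFunctor G} (φ : E ⟶ F) (n : ℕ) :
    tauIterStep α E n ≫ tauIterMap α φ (n + 1) = tauIterMap α φ n ≫ tauIterStep α F n := by
  induction n with
  | zero => exact tauUnit_naturality α φ
  | succ n ih => exact congrArg (tauMap α) ih

/-- Functoriality of the Taylor approximation in `E`. -/
def taylorMap (α ε : OrthRep G) {E F : WeissFunctor G} (φ : E ⟶ F) :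
    taylor α ε E ⟶ taylor α ε F :=
  hocolimMap (tauIterMap (α.sum ε) φ) (tauIterMap_naturality (α.sum ε) φ)

end WeissFunctor

end

end WeissCalculus

open WeissCalculus WeissCalculus.WeissFunctor

namespace WeissCalculus

namespace WeissFunctor

variable {G : Type u} [Group G]

/-! A point of `τ_α E` is a compatible family of functions on cells (flag, isometric embedding), and
two kinds of operation act on it. `tauRestrict` precomposes with transport of cells: a flag in the
smaller representation is pushed into the larger one along the embedding. `tauMap` postcomposes the
values with a 2-morphism. Precomposition and postcomposition commute on the nose, so every
interchange of the two below is a definitional equality and no homotopies appear.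

The unit `η` evaluates `E` on the restriction to `W` of the embedding `W ⊕ Uₙ → V`. Pushing the flag
forward does not touch this restriction, so restricting a homotopy limit carries the unit of the
larger representation to that of the smaller one. By induction on the number of iterations, the
restrictions of the iterates form a strictly commuting ladder between the two sequences
(`tauIterStep_tauIterRestrict`), hence a map of mapping telescopes. The same induction gives
naturality in `E` (`tauIterRestrict_naturality`). Compatibility with composition of embeddings
(`tauIterRestrict_trans`) also uses that transporting a cell twice is transporting it along the
composite (`Cell.trans_trans`).

All maps of telescopes involved preserve the cylinder and its coordinate, so the identities for the
Taylor approximations follow from the levelwise ones. The triangle between the units and the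
restriction is read off in the zeroth cylinder, where the restriction is the identity of `E`. -/

lemma hom_ext {E F : WeissFunctor G} {φ ψ : E ⟶ F}
    (h : ∀ {H : Subgroup G} (W : OrthRep H) (x : (E.obj W).carrier),
      Hom.app φ W x = Hom.app ψ W x) : φ = ψ :=
  Hom.ext (funext fun _ => funext fun W => funext fun x => h W x)

/-! ### Restriction of homotopy limits to a subrepresentation -/

/-- Restriction is contravariant in the embedding: evaluating a twice restricted family on a cell
over `α₂` pushes its flag first along `i₁` and then along `i`, which is one push along the
composite. -/
lemma tauRestrict_trans {α α₁ α₂ : OrthRep G} (i : α₁.Emb α) (i₁ : α₂.Emb α₁)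
    (E : WeissFunctor G) : tauRestrict i E ≫ tauRestrict i₁ E = tauRestrict (i₁.trans i) E :=
  hom_ext fun W Φ => HoLim.ext_val fun n V t c => by
    change HoLim.val Φ n V (t, Cell.trans _ _ _ (Cell.trans _ _ _ c)) =
      HoLim.val Φ n V (t, Cell.trans _ _ _ c)
    rw [Cell.trans_trans]
    rfl

/-- These are the squares of the ladder between the sequences for `α` and `α₁`. They commute
strictly, which is what the mapping telescope needs in order to be functorial without chosen
homotopies. -/
lemma tauIterStep_tauIterRestrict {α₁ α : OrthRep G} (i : α₁.Emb α) (E : WeissFunctor G)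
    (n : ℕ) : tauIterStep α E n ≫ tauIterRestrict i E (n + 1) =
      tauIterRestrict i E n ≫ tauIterStep α₁ E n := by
  induction n with
  -- The unit sees only `Cell.base`, and transport of a cell along `i` with identities on `W` and
  -- `V` leaves it unchanged. The remaining factors are identities.
  | zero => rfl
  | succ n ih =>
    -- The step maps at level `n + 1` are `tauMap` of those at level `n`, that is, postcompositions.
    -- On the left `tauMap α` of the step slides past the outermost restriction and becomes `tauMap
    -- α₁` of the same step, so both sides are, up to unfolding, the outermost restriction followed
    -- by `tauMap α₁` of a side of `ih`.
    exact congrArg (fun ψ => tauRestrict i (tauIter α E n) ≫ tauMap α₁ ψ) ih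

/-- The 2-morphism `φ` acts on the values in `E` and the restriction on the cells, at every stage of
the iteration. The induction peels off the outermost homotopy limit, as for the step maps. -/
lemma tauIterRestrict_naturality {α₁ α : OrthRep G} (i : α₁.Emb α) {E F : WeissFunctor G}
    (φ : E ⟶ F) (n : ℕ) : tauIterRestrict i E n ≫ tauIterMap α₁ φ n =
      tauIterMap α φ n ≫ tauIterRestrict i F n := by
  induction n with
  | zero => rfl
  | succ n ih =>
    exact congrArg (fun ψ => tauRestrict i (tauIter α E n) ≫ tauMap α₁ ψ) ih

lemma tauIterRestrict_trans {α α₁ α₂ : OrthRep G} (i : α₁.Emb α) (i₁ : α₂.Emb α₁)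
    (E : WeissFunctor G) (n : ℕ) : tauIterRestrict i E n ≫ tauIterRestrict i₁ E n =
      tauIterRestrict (i₁.trans i) E n := by
  induction n with
  | zero => rfl
  | succ n ih =>
    -- Interchange in the middle of the fourfold composite: `tauMap α₁ (tauIterRestrict i E n)`
    -- followed by the restriction along `i₁` equals that restriction, now on `tauIter α E n`,
    -- followed by `tauMap α₂` of the same map. This puts the two outer restrictions side by side
    -- and the two inner ones under a single `tauMap`.
    change (tauRestrict i (tauIter α E n) ≫ tauRestrict i₁ (tauIter α E n)) ≫
      tauMap α₂ (tauIterRestrict i E n ≫ tauIterRestrict i₁ E n) = _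
    rw [tauRestrict_trans, ih]
    rfl

/-- Taylor approximations iterate `τ` for `α ⊕ ε`, so embeddings enter only through their sums with
the identity of `ε`. This turns composites of such sums into sums of composites. -/
lemma sum_trans {α α₁ α₂ : OrthRep G} (i : α₁.Emb α) (i₁ : α₂.Emb α₁) (ε : OrthRep G) :
    (i₁.sum ε).trans (i.sum ε) = (i₁.trans i).sum ε := rfl

/-! ### The canonical maps of Taylor approximations -/

/-- The inclusion of the initial term of a sequence into its homotopy colimit. -/
noncomputable def hocolimIncl (X : ℕ → WeissFunctor G) (j : ∀ n, X n ⟶ X (n + 1)) : X 0 ⟶ hocolim X j where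
  -- Coordinate `0` in cylinder `0` is the free end of the telescope, and it is also where the base
  -- point of `hocolimObj` was placed. The action, the functor maps and the comparison maps of the
  -- telescope preserve the cylinder and its coordinate, so the remaining algebraic fields hold by
  -- `rfl`.
  app _ x := Tel.mk _ _ 0 x 0
  app_continuous W := (Tel.continuous_mk (pt := fun n => ((X n).obj W).pt)
    (j := fun n => Hom.app (j n) W) 0).comp (continuous_id.prodMk continuous_const)
  app_pt _ := rfl
  app_smul _ _ _ := rfl
  app_map _ _ _ _ := rfl
  app_res _ _ _ := rfl

/-- The canonical map from a functor to its Taylor approximation. -/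
noncomputable def taylorUnit (α ε : OrthRep G) (E : WeissFunctor G) : E ⟶ taylor α ε E :=
  hocolimIncl (tauIter (α.sum ε) E) (tauIterStep (α.sum ε) E)

/-- The map of Taylor approximations which restricts all homotopy limits along an equivariant
isometric embedding. -/
noncomputable def taylorRestrict {α α₁ : OrthRep G} (i : α₁.Emb α) (ε : OrthRep G) (E : WeissFunctor G) :
    taylor α ε E ⟶ taylor α₁ ε E :=
  hocolimMap (tauIterRestrict (i.sum ε) E) (tauIterStep_tauIterRestrict (i.sum ε) E)

/-- Every point of the telescope is represented in some cylinder. An equality of two given maps can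
be tested on representatives, with no gluing relation to check. -/
lemma taylor_hom_ext {α ε : OrthRep G} {E F : WeissFunctor G} {φ ψ : taylor α ε E ⟶ F}
    (h : ∀ {H : Subgroup G} (W : OrthRep H) (n : ℕ)
      (x : ((tauIter (α.sum ε) E n).obj W).carrier) (t : unitInterval),
      Hom.app φ W (taylorMk α ε E W n x t) = Hom.app ψ W (taylorMk α ε E W n x t)) : φ = ψ :=
  hom_ext fun W => Tel.ind (h W)

lemma taylorRestrict_naturality {α α₁ : OrthRep G} (i : α₁.Emb α) (ε : OrthRep G)
    {E F : WeissFunctor G} (φ : E ⟶ F) :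
    taylorRestrict i ε E ≫ taylorMap α₁ ε φ = taylorMap α ε φ ≫ taylorRestrict i ε F :=
  taylor_hom_ext fun W n x t => congrArg
    -- Both composites fix `n` and `t` and change only `x`, so the levelwise identity is applied to
    -- `x` and inserted into the cylinder.
    (fun ψ : Hom (tauIter (α.sum ε) E n) (tauIter (α₁.sum ε) F n) =>
      taylorMk α₁ ε F W n (ψ.app W x) t) (tauIterRestrict_naturality (i.sum ε) φ n)

lemma taylorRestrict_trans {α α₁ α₂ : OrthRep G} (i : α₁.Emb α) (i₁ : α₂.Emb α₁)
    (ε : OrthRep G) (E : WeissFunctor G) :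
    taylorRestrict i ε E ≫ taylorRestrict i₁ ε E = taylorRestrict (i₁.trans i) ε E :=
  taylor_hom_ext fun W n x t => congrArg
    (fun ψ : Hom (tauIter (α.sum ε) E n) (tauIter (α₂.sum ε) E n) =>
      taylorMk α₂ ε E W n (ψ.app W x) t)
    ((tauIterRestrict_trans (i.sum ε) (i₁.sum ε) E n).trans
      (congrArg (fun k => tauIterRestrict k E n) (sum_trans i i₁ ε)))

end WeissFunctor

end WeissCalculus

theorem theoremA (G : Type u) [Group G] [Finite G] (ε : OrthRep G)
    (hε : Module.finrank ℝ ε.carrier = 1) :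
    ∃ (η : ∀ (α : OrthRep G) (E : WeissFunctor G), E ⟶ taylor α ε E)
      (ρ : ∀ {α α₁ : OrthRep G}, α₁.Emb α → ∀ E : WeissFunctor G, taylor α ε E ⟶ taylor α₁ ε E),
      -- `η` is the canonical map of `E = τ^0 E` to the homotopy colimit
      (∀ (α : OrthRep G) (E : WeissFunctor G) {H : Subgroup G} (W : OrthRep H)
        (x : (E.obj W).carrier), Hom.app (η α E) W x = taylorMk α ε E W 0 x 0) ∧
      -- `ρ` is induced by restricting all homotopy limits from `α ⊕ ε` to `α₁ ⊕ ε`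
      (∀ {α α₁ : OrthRep G} (i : α₁.Emb α) (E : WeissFunctor G) {H : Subgroup G} (W : OrthRep H)
        (n : ℕ) (x : ((tauIter (α.sum ε) E n).obj W).carrier) (t : unitInterval),
        Hom.app (ρ i E) W (taylorMk α ε E W n x t) =
          taylorMk α₁ ε E W n (Hom.app (tauIterRestrict (i.sum ε) E n) W x) t) ∧
      -- both are natural in `E`
      (∀ (α : OrthRep G) {E F : WeissFunctor G} (φ : E ⟶ F),
        η α E ≫ taylorMap α ε φ = φ ≫ η α F) ∧
      (∀ {α α₁ : OrthRep G} (i : α₁.Emb α) {E F : WeissFunctor G} (φ : E ⟶ F),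
        ρ i E ≫ taylorMap α₁ ε φ = taylorMap α ε φ ≫ ρ i F) ∧
      -- the compatibility identities
      (∀ {α α₁ : OrthRep G} (i : α₁.Emb α) (E : WeissFunctor G), η α E ≫ ρ i E = η α₁ E) ∧
      ∀ {α α₁ α₂ : OrthRep G} (i : α₁.Emb α) (i₁ : α₂.Emb α₁) (E : WeissFunctor G),
        ρ i E ≫ ρ i₁ E = ρ (i₁.trans i) E :=
  ⟨fun α E => taylorUnit α ε E, fun i E => taylorRestrict i ε E, fun _ _ _ _ _ => rfl,
    fun _ _ _ _ _ _ _ => rfl, fun _ _ _ _ => rfl,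
    -- The `rfl` here is the triangle of `η` and `ρ`: the image of `η` lies in cylinder `0`, where
    -- `tauIterRestrict` is the identity of `E` by definition, so `(x, 0)` goes to `(x, 0)`.
    fun i _ _ φ => taylorRestrict_naturality i ε φ, fun _ _ => rfl,
    fun i i₁ E => taylorRestrict_trans i i₁ ε E⟩
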